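/- Let $p$ be a prime number, $n\in\mathbb N$, $q=p^n$, $\mathbb F_q$ a field with $q$ elements (so $n\ge 1$), and $\theta$ the Frobenius map $\theta(a)=a^p$ of $\mathbb F_q$. Let $R=\mathbb F_q[t;\theta]$ be the skew polynomial ring whose elements are the polynomials $\sum_i a_it^i$ with $a_i\in\mathbb F_q$, added as usual and multiplied by the rule $ta=\theta(a)t$ for $a\in\mathbb F_q$. Extend $\theta$ to a ring endomorphism of $R$ by $\theta(t)=t$. A monic $m\in R$ is the least left common multiple of a set $S\subseteq R$ if $m\in Rs$ for all $s\in S$, and every $f\in R$ with $f\in Rs$ for all $s\in S$ lies in $Rm$. A monic $g\in R$ of degree $r\ge 0$ is a Wedderburn polynomial (W-polynomial) if there are $a_1,\dots,a_r\in\mathbb F_q$ such that $Rg=\bigcap_{i=1}^{r}R(t-a_i)$ (the empty intersection being $R$). Theorem. Put $G=t^{(p-1)n+1}-t$ and $G_0=t^{(p-1)n}-1$ in $R$. (a) $G$ (resp. $G_0$) is the least left common multiple of all the linear polynomials $t-a$ with $a\in\mathbb F_q$ (resp. with $0\neq a\in\mathbb F_q$). (b) For every $h\in R$ we have $G\,h=\theta(h)\,G$.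 The polynomial $G_0$ belongs to the center of $R$. (c) Let $g,h\in R$ be monic. If $hg=G$, then $\theta(g)h=G$. If $hg=G_0$, then $gh=G_0$. (d) The W-polynomials are exactly the monic right factors of $G$, and also exactly the monic left factors of $G$: for every $g\in R$, $g$ is a W-polynomial if and only if $g$ is monic and $G=hg$ for some $h\in R$, and if and only if $g$ is monic and $G=gh$ for some $h\in R$. -/

import Mathlib

/-- The action of the free monoid on one generator on `A` in which the generator acts as the
ring endomorphism `σ`. With this action in force, `SkewPolynomial A` is the Ore extension
`A[t;σ]`, whose multiplication is determined by `t * a = σ a * t`. -/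
abbrev endomorphismAction {A : Type*} [Semiring A] (σ : A →+* A) :
    MulSemiringAction (Multiplicative ℕ) A :=
  MulSemiringAction.compHom A (powersHom (A →+* A) σ)

theorem endomorphismAction_phi {A : Type*} [Semiring A] (σ : A →+* A) :
    letI := endomorphismAction σ
    (SkewPolynomial.φ : A →+* A) = σ := by
  let _ := endomorphismAction σ
  ext a
  change (powersHom (A →+* A) σ (Multiplicative.ofAdd 1)) a = σ a
  simp [powersHom_apply]

namespace SkewPolynomial

variable {A : Type*} [Ring A] [MulSemiringAction (Multiplicative ℕ) A]

/-- The commutation law `t * a = σ a * t` of the skew polynomial ring. -/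
theorem X_mul_C_eq (a : A) : (X : SkewPolynomial A) * C a = C (φ a) * X := by
  simp [X]

theorem X_pow_mul_C_eq (k : ℕ) (a : A) :
    (X : SkewPolynomial A) ^ k * C a = C (φ^[k] a) * X ^ k := by
  rw [← monomial_one_right_eq_X_pow, monomial_mul_C, C_mul_monomial, one_mul, mul_one]

/-- The extension of the twisting endomorphism `σ` of `A` to a ring endomorphism of `A[t;σ]`
that fixes `t`. -/
noncomputable def extendPhi : SkewPolynomial A →+* SkewPolynomial A :=
  SkewMonoidAlgebra.liftNCRingHom ((CRingHom : A →+* SkewPolynomial A).comp φ)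
    (powersHom (SkewPolynomial A) X) (by
      intro x y
      have h : y • x = φ^[Multiplicative.toAdd y] x := (φ_iterate_apply _ x).symm
      rw [powersHom_apply, RingHom.comp_apply, RingHom.comp_apply, CRingHom_eq_C, CRingHom_eq_C,
        X_pow_mul_C_eq, h, ← Function.iterate_succ_apply (f := φ), Function.iterate_succ_apply'])

theorem extendPhi_monomial (k : ℕ) (a : A) :
    extendPhi (monomial k a) = monomial k (φ a) := by
  change SkewMonoidAlgebra.liftNC _ _ (SkewMonoidAlgebra.single _ _) = _
  rw [SkewMonoidAlgebra.liftNC_single]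
  change C (φ a) * powersHom (SkewPolynomial A) X (Multiplicative.ofAdd k) = _
  rw [powersHom_apply, toAdd_ofAdd, ← monomial_one_right_eq_X_pow, C_mul_monomial, mul_one]

/-- `f` has degree `r` and leading coefficient `1`. -/
def IsMonicOfDegree (f : SkewPolynomial A) (r : ℕ) : Prop :=
  f.coeff r = 1 ∧ ∀ i, r < i → f.coeff i = 0

/-- `f` has leading coefficient `1`. -/
def IsMonic (f : SkewPolynomial A) : Prop :=
  ∃ r, IsMonicOfDegree f r

/-- `m` is a left common multiple of the elements of `S`, that is, `m ∈ R s` for all `s ∈ S`. -/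
def IsLeftCommonMultiple (S : Set (SkewPolynomial A)) (m : SkewPolynomial A) : Prop :=
  ∀ s ∈ S, ∃ u, m = u * s

/-- `m` is the (monic) least left common multiple of the elements of `S`: it is a left common
multiple, and every left common multiple is a left multiple of `m`. -/
def IsLeastLeftCommonMultiple (S : Set (SkewPolynomial A)) (m : SkewPolynomial A) : Prop :=
  IsMonic m ∧ IsLeftCommonMultiple S m ∧ ∀ f, IsLeftCommonMultiple S f → ∃ u, f = u * m

/-- A Wedderburn polynomial (W-polynomial): a monic `g` of some degree `r` such that
`R g = ⋂ i, R (t - a i)` for some `a 1, …, a r ∈ A`. (`Ideal` means left ideal, and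
`Ideal.span {f}` is `R f`; for `r = 0` the empty intersection is `R`.) -/
def IsWPolynomial (g : SkewPolynomial A) : Prop :=
  ∃ r, IsMonicOfDegree g r ∧
    ∃ a : Fin r → A, Ideal.span {g} = ⨅ i, Ideal.span {(X - C (a i) : SkewPolynomial A)}

/-- The skew polynomial `G = t ^ ((p - 1) * n + 1) - t`. -/
noncomputable def polyG (A : Type*) [Ring A] [MulSemiringAction (Multiplicative ℕ) A] (p n : ℕ) :
    SkewPolynomial A :=
  X ^ ((p - 1) * n + 1) - X

/-- The skew polynomial `G₀ = t ^ ((p - 1) * n) - 1`. -/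
noncomputable def polyG₀ (A : Type*) [Ring A] [MulSemiringAction (Multiplicative ℕ) A] (p n : ℕ) :
    SkewPolynomial A :=
  X ^ ((p - 1) * n) - 1

end SkewPolynomial

open SkewPolynomial

/-! For each a, the ring R acts on F with t acting as c ↦ a θ(c), and f·1 is the remainder of f on
right division by t - a. Hence membership in R(t - a) means vanishing at a (`act_one_eq_zero_iff`).
The value of t^i at a is a^(1+p+...+p^(i-1)). Modulo a^q = a, the exponents for i < (p-1)n become
distinct numbers below q - 1, while i = (p-1)n gives q - 1. So G₀ vanishes on F \ {0}, and a
remainder of smaller degree vanishing there is an ordinary polynomial of degree < q - 1 with q - 1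
roots, hence zero. This gives (a), with G = tG₀ handling a = 0.

Since θ^n = 1, t^((p-1)n) is central, whence (b); cancellation in the domain R gives (c), and
applying powers of θ exchanges left and right factors of G.

For (d), write G = gw: then f ∈ Rg iff fw vanishes everywhere, which by the product formula
`act_eq_zero_iff` says that f vanishes on a set of conjugates. So Rg is an intersection of ideals
R(t - b), and deg g of them suffice. -/

namespace SkewPolynomial

/-! ### Degrees, cancellation and right division -/

section Degree

variable {F : Type*} [Field F]

theorem exists_leading_coeff {f : SkewPolynomial F} (hf : f ≠ 0) :
    ∃ k, f.coeff k ≠ 0 ∧ ∀ i, k < i → f.coeff i = 0 := by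
  have hs : f.support.Nonempty := by
    rw [Finset.nonempty_iff_ne_empty]
    simpa using hf
  refine ⟨f.support.max' hs, mem_support_iff.1 (Finset.max'_mem _ _), fun i hi => ?_⟩
  by_contra h
  exact absurd (Finset.le_max' _ _ (mem_support_iff.2 h)) (not_le.2 hi)

theorem IsMonicOfDegree.ne_zero {f : SkewPolynomial F} {k : ℕ} (hf : IsMonicOfDegree f k) :
    f ≠ 0 := by
  rintro rfl
  exact zero_ne_one hf.1

theorem isMonicOfDegree_X_sub_C (a : F) : IsMonicOfDegree (X - C a : SkewPolynomial F) 1 := by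
  refine ⟨by simp, fun i hi => ?_⟩
  rw [coeff_sub, coeff_X_of_ne_one hi.ne', coeff_C_ne_zero (by omega), sub_zero]

variable [MulSemiringAction (Multiplicative ℕ) F]

theorem coeff_monomial_mul (k : ℕ) (a : F) (f : SkewPolynomial F) (n : ℕ) :
    (monomial k a * f).coeff n = if k ≤ n then a * φ^[k] (f.coeff (n - k)) else 0 := by
  induction f using SkewPolynomial.induction with
  | h0 => simp [iterate_map_zero]
  | ha m r q _ _ ih =>
    rw [mul_add, coeff_add, ih, monomial_mul_monomial, coeff_monomial, coeff_add, coeff_monomial]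
    by_cases hk : k ≤ n
    · by_cases hm : k + m = n
      · have : m = n - k := by omega
        simp [hk, this, iterate_map_add, mul_add]
      · have : m ≠ n - k := by omega
        simp [hk, hm, this]
    · have : k + m ≠ n := by omega
      simp [hk, this]

theorem coeff_mul_eq_sum (f g : SkewPolynomial F) (n : ℕ) :
    (f * g).coeff n =
      ∑ k ∈ f.support, if k ≤ n then f.coeff k * φ^[k] (g.coeff (n - k)) else 0 := by
  rw [← sum_def (f := fun k a => if k ≤ n then a * φ^[k] (g.coeff (n - k)) else 0)]
  induction f using SkewPolynomial.induction with
  | h0 => simp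
  | ha m r q _ _ ih =>
    rw [add_mul, coeff_add, ih, coeff_monomial_mul, sum_add_index, sum_monomial_index]
    · simp
    · simp
    · intro a b₁ b₂
      split_ifs <;> simp [add_mul]

theorem coeff_mul_add_of_le {f g : SkewPolynomial F} {k l : ℕ}
    (hf : ∀ i, k < i → f.coeff i = 0) (hg : ∀ i, l < i → g.coeff i = 0) :
    (f * g).coeff (k + l) = f.coeff k * φ^[k] (g.coeff l) := by
  rw [coeff_mul_eq_sum, Finset.sum_eq_single k]
  · simp
  · intro i _ hi
    split_ifs
    · rcases lt_or_gt_of_ne hi with h | h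
      · rw [hg _ (by omega), iterate_map_zero, mul_zero]
      · rw [hf _ h, zero_mul]
    · rfl
  · intro h
    simp [notMem_support_iff.1 h]

theorem coeff_mul_eq_zero_of_lt {f g : SkewPolynomial F} {k l : ℕ}
    (hf : ∀ i, k < i → f.coeff i = 0) (hg : ∀ i, l < i → g.coeff i = 0) {n : ℕ}
    (hn : k + l < n) : (f * g).coeff n = 0 := by
  rw [coeff_mul_eq_sum]
  refine Finset.sum_eq_zero fun i _ => ?_
  split_ifs
  · by_cases h : k < i
    · rw [hf _ h, zero_mul]
    · rw [hg _ (by omega), iterate_map_zero, mul_zero]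
  · rfl

theorem iterate_phi_ne_zero (k : ℕ) {a : F} (ha : a ≠ 0) : φ^[k] a ≠ 0 := by
  intro h
  exact ha ((φ : F →+* F).injective.iterate k (h.trans (iterate_map_zero _ _).symm))

instance : NoZeroDivisors (SkewPolynomial F) where
  eq_zero_or_eq_zero_of_mul_eq_zero {f g} h := by
    by_contra! H
    obtain ⟨k, hk, hk'⟩ := exists_leading_coeff H.1
    obtain ⟨l, hl, hl'⟩ := exists_leading_coeff H.2
    refine mul_ne_zero hk (iterate_phi_ne_zero k hl) ?_
    rw [← coeff_mul_add_of_le hk' hl', h, coeff_zero]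

theorem IsMonicOfDegree.mul {f g : SkewPolynomial F} {k l : ℕ} (hf : IsMonicOfDegree f k)
    (hg : IsMonicOfDegree g l) : IsMonicOfDegree (f * g) (k + l) := by
  refine ⟨?_, fun i hi => coeff_mul_eq_zero_of_lt hf.2 hg.2 hi⟩
  rw [coeff_mul_add_of_le hf.2 hg.2, hf.1, hg.1, iterate_map_one, one_mul]

theorem isMonicOfDegree_one : IsMonicOfDegree (1 : SkewPolynomial F) 0 :=
  ⟨by simp, fun i hi => by simp [coeff_one, hi.ne]⟩

theorem degree_le_of_eq_mul {f u g : SkewPolynomial F} {k l : ℕ} (hf : IsMonicOfDegree f k)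
    (hg : IsMonicOfDegree g l) (h : f = u * g) : l ≤ k := by
  have hu : u ≠ 0 := by
    rintro rfl
    exact hf.ne_zero (by rw [h, zero_mul])
  obtain ⟨j, hj, hj'⟩ := exists_leading_coeff hu
  by_contra! hlt
  have := coeff_mul_add_of_le hj' hg.2
  rw [← h, hf.2 _ (by omega), hg.1, iterate_map_one, mul_one] at this
  exact hj this.symm

theorem eq_of_eq_mul {f u g : SkewPolynomial F} {k : ℕ} (hf : IsMonicOfDegree f k)
    (hg : IsMonicOfDegree g k) (h : f = u * g) : f = g := by
  have hu : u ≠ 0 := by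
    rintro rfl
    exact hf.ne_zero (by rw [h, zero_mul])
  obtain ⟨j, hj, hj'⟩ := exists_leading_coeff hu
  have hc := coeff_mul_add_of_le hj' hg.2
  rw [← h, hg.1, iterate_map_one, mul_one] at hc
  obtain rfl : j = 0 := by
    by_contra h0
    exact hj (hc.symm.trans (hf.2 _ (by omega)))
  rw [zero_add, hf.1] at hc
  have hu1 : u = 1 := by
    ext i
    rcases Nat.eq_zero_or_pos i with rfl | hi
    · simp [← hc]
    · simp [hj' i hi, coeff_one, hi.ne]
  rw [h, hu1, one_mul]

/-- Division on the right by a monic skew polynomial. -/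
theorem exists_eq_mul_add {m : SkewPolynomial F} {k : ℕ} (hm : IsMonicOfDegree m k)
    (f : SkewPolynomial F) : ∃ u r, f = u * m + r ∧ ∀ i, k ≤ i → r.coeff i = 0 := by
  obtain ⟨N, hN⟩ : ∃ N, ∀ i, N ≤ i → f.coeff i = 0 := by
    by_cases hf : f = 0
    · exact ⟨0, fun i _ => by simp [hf]⟩
    · obtain ⟨j, -, hj⟩ := exists_leading_coeff hf
      exact ⟨j + 1, fun i hi => hj i hi⟩
  induction N generalizing f with
  | zero => exact ⟨0, f, by simp, fun i _ => hN i (Nat.zero_le i)⟩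
  | succ N ih =>
    by_cases hk : N < k
    · exact ⟨0, f, by simp, fun i hi => hN i (by omega)⟩
    · obtain ⟨u, r, h, hr⟩ := ih (f - monomial (N - k) (f.coeff N) * m) (by
        intro i hi
        rw [coeff_sub, coeff_monomial_mul, if_pos (by omega)]
        rcases hi.eq_or_lt with rfl | hi
        · rw [Nat.sub_sub_self (by omega), hm.1, iterate_map_one, mul_one, sub_self]
        · rw [hm.2 _ (by omega), hN i hi, iterate_map_zero, mul_zero, sub_zero])
      refine ⟨u + monomial (N - k) (f.coeff N), r, ?_, hr⟩
      rw [add_mul, add_right_comm, ← h, sub_add_cancel]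

theorem exists_eq_mul_X_sub_C_add_C (a : F) (f : SkewPolynomial F) :
    ∃ u r, f = u * (X - C a) + C r := by
  obtain ⟨u, r, h, hr⟩ := exists_eq_mul_add (isMonicOfDegree_X_sub_C a) f
  refine ⟨u, r.coeff 0, ?_⟩
  convert h
  ext i
  rcases Nat.eq_zero_or_pos i with rfl | hi
  · simp
  · rw [coeff_C_ne_zero hi.ne', hr i hi]

end Degree

end SkewPolynomial

namespace SkewPolynomial

/-! ### Evaluation as an action on F; intersections of the ideals R(t - b) -/

section Action

variable {F : Type*} [Field F] [MulSemiringAction (Multiplicative ℕ) F]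

/-- The additive endomorphism `c ↦ a * φ c`. -/
noncomputable def twist (a : F) : AddMonoid.End F :=
  (AddMonoidHom.mulLeft a).comp (φ : F →+* F).toAddMonoidHom

theorem twist_apply (a c : F) : twist a c = a * φ c := rfl

theorem twist_pow_succ_apply (a c : F) (k : ℕ) :
    (twist a ^ (k + 1)) c = a * φ ((twist a ^ k) c) := by
  rw [pow_succ']
  rfl

theorem twist_pow_mul (a b c : F) (k : ℕ) :
    (twist a ^ k) (b * c) = φ^[k] b * (twist a ^ k) c := by
  induction k with
  | zero => simp
  | succ k ih =>
    rw [twist_pow_succ_apply, twist_pow_succ_apply, ih, map_mul, Function.iterate_succ_apply']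
    ring

/-- The action of `F[t;φ]` on `F` in which constants act by multiplication and `t` acts as
`c ↦ a * φ c`. -/
noncomputable def act (a : F) : SkewPolynomial F →+* AddMonoid.End F :=
  SkewMonoidAlgebra.liftNCRingHom (Module.toAddMonoidEnd F F)
    (powersHom (AddMonoid.End F) (twist a)) (by
      intro x y
      refine AddMonoidHom.ext fun c => ?_
      have h : y • x = φ^[Multiplicative.toAdd y] x := (φ_iterate_apply _ x).symm
      rw [powersHom_apply, h]
      exact (twist_pow_mul a x c _).symm)

theorem act_monomial (a : F) (k : ℕ) (b c : F) :
    act a (monomial k b) c = b * (twist a ^ k) c := by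
  exact DFunLike.congr_fun (SkewMonoidAlgebra.liftNC_single
    (Module.toAddMonoidEnd F F : F →+ AddMonoid.End F)
    (powersHom (AddMonoid.End F) (twist a)) (Multiplicative.ofAdd k) b) c

theorem act_C (a b c : F) : act a (C b) c = b * c := act_monomial a 0 b c

theorem act_X (a c : F) : act a X c = a * φ c := by
  rw [X, act_monomial, pow_one, one_mul, twist_apply]

theorem act_X_pow (a c : F) (k : ℕ) : act a (X ^ k) c = (twist a ^ k) c := by
  rw [← monomial_one_right_eq_X_pow, act_monomial, one_mul]

theorem act_mul (a : F) (f g : SkewPolynomial F) (c : F) :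
    act a (f * g) c = act a f (act a g c) := by
  rw [map_mul]
  rfl

theorem act_add (a : F) (f g : SkewPolynomial F) (c : F) :
    act a (f + g) c = act a f c + act a g c := by
  rw [map_add]
  rfl

theorem act_sub (a : F) (f g : SkewPolynomial F) (c : F) :
    act a (f - g) c = act a f c - act a g c := by
  rw [map_sub]
  rfl

/-- Product formula: t - aθ(c)c⁻¹ kills c, so dividing f by it on the right leaves a constant r with
f·c = rc. -/
theorem act_eq_zero_iff (a : F) {c : F} (hc : c ≠ 0) (f : SkewPolynomial F) :
    act a f c = 0 ↔ ∃ u, f = u * (X - C (a * φ c * c⁻¹)) := by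
  have h0 : act a (X - C (a * φ c * c⁻¹)) c = 0 := by
    rw [act_sub, act_X, act_C, inv_mul_cancel_right₀ hc, sub_self]
  constructor
  · intro h
    obtain ⟨u, r, rfl⟩ := exists_eq_mul_X_sub_C_add_C (a * φ c * c⁻¹) f
    rw [act_add, act_mul, h0, map_zero, zero_add, act_C] at h
    rw [(mul_eq_zero.1 h).resolve_right hc, C_0, add_zero]
    exact ⟨u, rfl⟩
  · rintro ⟨u, rfl⟩
    rw [act_mul, h0, map_zero]

theorem act_one_eq_zero_iff (a : F) (f : SkewPolynomial F) :
    act a f 1 = 0 ↔ ∃ u, f = u * (X - C a) := by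
  simpa using act_eq_zero_iff a one_ne_zero f

theorem mem_span_singleton_iff {f g : SkewPolynomial F} :
    f ∈ Ideal.span {g} ↔ ∃ u, f = u * g := by
  rw [Ideal.mem_span_singleton']
  exact ⟨fun ⟨u, h⟩ => ⟨u, h.symm⟩, fun ⟨u, h⟩ => ⟨u, h.symm⟩⟩

/-- Adjoining a further linear polynomial to a least left common multiple `m`. -/
theorem span_inf_span_X_sub_C {m : SkewPolynomial F} {b : F} (hb : act b m 1 ≠ 0) :
    Ideal.span {m} ⊓ Ideal.span {X - C b} =
      Ideal.span {(X - C (b * φ (act b m 1) * (act b m 1)⁻¹)) * m} := by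
  ext f
  rw [Ideal.mem_inf]
  simp only [mem_span_singleton_iff]
  rw [← act_one_eq_zero_iff]
  constructor
  · rintro ⟨⟨u, rfl⟩, h⟩
    rw [act_mul, act_eq_zero_iff b hb] at h
    obtain ⟨v, rfl⟩ := h
    exact ⟨v, mul_assoc _ _ _⟩
  · rintro ⟨u, rfl⟩
    refine ⟨⟨_, (mul_assoc _ _ _).symm⟩, ?_⟩
    rw [← mul_assoc, act_mul, act_eq_zero_iff b hb]
    exact ⟨u, rfl⟩

/-- A monic skew polynomial `g` such that `R g` is an intersection of left ideals `R (t - b)` is a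
W-polynomial. -/
theorem isWPolynomial_of_forall_mem_iff {g : SkewPolynomial F} (hg : IsMonic g) (B : Set F)
    (h : ∀ f, (∃ u, f = u * g) ↔ ∀ b ∈ B, act b f 1 = 0) : IsWPolynomial g := by
  obtain ⟨r, hr⟩ := hg
  have key : ∀ k ≤ r, ∃ (m : SkewPolynomial F) (a : Fin k → F), IsMonicOfDegree m k ∧
      (∃ u, g = u * m) ∧
      Ideal.span {m} = ⨅ i, Ideal.span {(X - C (a i) : SkewPolynomial F)} := by
    intro k hk
    induction k with
    | zero =>
      exact ⟨1, Fin.elim0, isMonicOfDegree_one, ⟨g, (mul_one g).symm⟩,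
        by rw [iInf_of_empty, Ideal.span_singleton_one]⟩
    | succ k ih =>
      obtain ⟨m, a, hm, hgm, hspan⟩ := ih (by omega)
      -- Since deg m = k < deg g, m is not in Rg, so m fails to vanish somewhere on B; adjoining
      -- such a b raises the degree by exactly one.
      obtain ⟨b, hbB, hb⟩ : ∃ b ∈ B, act b m 1 ≠ 0 := by
        by_contra! H
        obtain ⟨u, hu⟩ := (h m).2 H
        have := degree_le_of_eq_mul hm hr hu
        omega
      have hinf := span_inf_span_X_sub_C hb
      refine ⟨_, Fin.snoc a b, add_comm 1 k ▸ (isMonicOfDegree_X_sub_C _).mul hm,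
        ?_, hinf.symm.trans ?_⟩
      · rw [← mem_span_singleton_iff, ← hinf]
        refine ⟨mem_span_singleton_iff.2 hgm, mem_span_singleton_iff.2 ?_⟩
        exact (act_one_eq_zero_iff b g).1 ((h g).1 ⟨1, (one_mul g).symm⟩ b hbB)
      · rw [hspan]
        ext f
        simp [Submodule.mem_iInf, Fin.forall_fin_succ']
  obtain ⟨m, a, hm, ⟨u, hu⟩, hspan⟩ := key r le_rfl
  rw [← eq_of_eq_mul hr hm hu] at hspan
  exact ⟨r, hr, a, hspan⟩

end Action
end SkewPolynomial

namespace SkewPolynomial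

/-! ### Commutation with G and G₀, and their factorizations -/

section PolyG

/-- Splitting off the first n terms of the geometric sum leaves p^n times a shorter sum, and the
factor p^n is absorbed by a^(p^n) = a. -/
theorem pow_geom_sum_add_mul {M : Type*} [Monoid M] {p n : ℕ} (hM : ∀ a : M, a ^ p ^ n = a)
    (a : M) (j k : ℕ) :
    a ^ ∑ i ∈ Finset.range (j + k * n), p ^ i =
      a ^ (∑ i ∈ Finset.range j, p ^ i + k * ∑ i ∈ Finset.range n, p ^ i) := by
  induction k with
  | zero => simp
  | succ k ih =>
    rw [add_mul k, one_mul, ← add_assoc, add_comm (j + k * n) n, Finset.sum_range_add]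
    simp_rw [pow_add p n]
    rw [← Finset.mul_sum, pow_add a, pow_mul, hM, ih, ← pow_add]
    congr 1
    ring

theorem geom_sum_mul_pred {p : ℕ} (hp : p.Prime) (n : ℕ) :
    (p - 1) * ∑ i ∈ Finset.range n, p ^ i = p ^ n - 1 := by
  rw [Nat.geomSum_eq hp.two_le, Nat.mul_div_cancel']
  simpa using Nat.sub_dvd_pow_sub_pow p 1 n

variable {F : Type*} [Field F] [MulSemiringAction (Multiplicative ℕ) F]

theorem X_mul_eq_extendPhi_mul_X (h : SkewPolynomial F) : X * h = extendPhi h * X := by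
  induction h using SkewPolynomial.induction with
  | h0 => simp
  | ha m r q _ _ ih =>
    rw [mul_add, ih, map_add, add_mul, extendPhi_monomial, X_mul_monomial, monomial_mul_X]

theorem extendPhi_X : extendPhi (X : SkewPolynomial F) = X := by
  rw [X, extendPhi_monomial, map_one]

variable (p n : ℕ)

theorem polyG_eq_X_mul : polyG F p n = X * polyG₀ F p n := by
  rw [polyG, polyG₀, mul_sub, mul_one, pow_succ']

theorem extendPhi_polyG : extendPhi (polyG F p n) = polyG F p n := by
  rw [polyG, map_sub, map_pow, extendPhi_X]

theorem isMonicOfDegree_X_pow_sub {k : ℕ} {r : SkewPolynomial F}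
    (hr : ∀ i, k ≤ i → r.coeff i = 0) : IsMonicOfDegree (X ^ k - r) k := by
  rw [← monomial_one_right_eq_X_pow]
  refine ⟨?_, fun i hi => ?_⟩
  · rw [coeff_sub, coeff_monomial, if_pos rfl, hr k le_rfl, sub_zero]
  · rw [coeff_sub, coeff_monomial, if_neg hi.ne, hr i hi.le, sub_zero]

variable {p n}

theorem isMonicOfDegree_polyG₀ (hd : 0 < (p - 1) * n) :
    IsMonicOfDegree (polyG₀ F p n) ((p - 1) * n) :=
  isMonicOfDegree_X_pow_sub fun i hi => by rw [coeff_one, if_neg (by omega)]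

theorem isMonicOfDegree_polyG (hd : 0 < (p - 1) * n) :
    IsMonicOfDegree (polyG F p n) ((p - 1) * n + 1) :=
  isMonicOfDegree_X_pow_sub fun i hi => coeff_X_of_ne_one (by omega)

theorem polyG₀_mul_comm (hn : ∀ a : F, φ^[n] a = a) (h : SkewPolynomial F) :
    polyG₀ F p n * h = h * polyG₀ F p n := by
  have hd (a : F) : φ^[(p - 1) * n] a = a := by
    rw [mul_comm, Function.iterate_mul]
    exact Function.iterate_fixed (hn a) _
  rw [polyG₀, sub_mul, mul_sub, one_mul, mul_one, sub_left_inj]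
  induction h using SkewPolynomial.induction with
  | h0 => simp
  | ha m r q _ _ ih =>
    rw [mul_add, ih, add_mul, X_pow_mul_monomial, monomial_mul_X_pow, hd]

theorem polyG_mul (hn : ∀ a : F, φ^[n] a = a) (h : SkewPolynomial F) :
    polyG F p n * h = extendPhi h * polyG F p n := by
  rw [polyG_eq_X_mul, mul_assoc, polyG₀_mul_comm hn, ← mul_assoc, X_mul_eq_extendPhi_mul_X,
    mul_assoc]

/-- θ(g)hg = θ(g)G = Gg; cancel g on the right. -/
theorem extendPhi_mul_of_mul_eq_polyG (hn : ∀ a : F, φ^[n] a = a) (hd : 0 < (p - 1) * n)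
    {g h : SkewPolynomial F} (H : h * g = polyG F p n) : extendPhi g * h = polyG F p n := by
  have hg : g ≠ 0 := by
    rintro rfl
    exact (isMonicOfDegree_polyG (F := F) hd).ne_zero (by rw [← H, mul_zero])
  refine mul_right_cancel₀ hg ?_
  rw [mul_assoc, H, polyG_mul hn]

theorem mul_comm_of_mul_eq_polyG₀ (hn : ∀ a : F, φ^[n] a = a) (hd : 0 < (p - 1) * n)
    {g h : SkewPolynomial F} (H : h * g = polyG₀ F p n) : g * h = polyG₀ F p n := by
  have hg : g ≠ 0 := by
    rintro rfl
    exact (isMonicOfDegree_polyG₀ (F := F) hd).ne_zero (by rw [← H, mul_zero])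
  refine mul_right_cancel₀ hg ?_
  rw [mul_assoc, H, polyG₀_mul_comm hn]

theorem extendPhi_iterate (hn : ∀ a : F, φ^[n] a = a) (h : SkewPolynomial F) :
    extendPhi^[n] h = h := by
  have hmon (k m : ℕ) (a : F) : extendPhi^[k] (monomial m a) = monomial m (φ^[k] a) := by
    induction k with
    | zero => rfl
    | succ k ih => rw [Function.iterate_succ_apply', ih, extendPhi_monomial,
        Function.iterate_succ_apply']
  induction h using SkewPolynomial.induction with
  | h0 => exact iterate_map_zero _ _
  | ha m r q _ _ ih => rw [iterate_map_add, ih, hmon, hn]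

/-- θ has finite order on R and fixes G, so hg = G ⇒ θ(g)h = G can be untwisted. -/
theorem exists_polyG_eq_mul_right_iff (hn : ∀ a : F, φ^[n] a = a) (hd : 0 < (p - 1) * n)
    (g : SkewPolynomial F) : (∃ h, polyG F p n = g * h) ↔ ∃ h, polyG F p n = h * g := by
  constructor
  · rintro ⟨h, H⟩
    exact ⟨extendPhi h, (extendPhi_mul_of_mul_eq_polyG hn hd H.symm).symm⟩
  · rintro ⟨h, H⟩
    have H' := extendPhi_mul_of_mul_eq_polyG hn hd H.symm
    obtain ⟨k, rfl⟩ : ∃ k, n = k + 1 := ⟨n - 1, by have := Nat.pos_of_mul_pos_left hd; omega⟩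
    have hfix : extendPhi^[k] (polyG F p (k + 1)) = polyG F p (k + 1) :=
      Function.iterate_fixed (extendPhi_polyG p (k + 1)) k
    refine ⟨extendPhi^[k] h, ?_⟩
    -- Applying θ^(n-1) to θ(g)h = G turns θ(g) back into g.
    rw [← hfix, ← H', iterate_map_mul, ← Function.iterate_succ_apply, extendPhi_iterate hn]

/-- The value at `a` of a skew polynomial, when `φ` is the `p`-power map. -/
theorem twist_pow_one (hp : ∀ a : F, φ a = a ^ p) (a : F) (k : ℕ) :
    (twist a ^ k) 1 = a ^ ∑ i ∈ Finset.range k, p ^ i := by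
  induction k with
  | zero => simp
  | succ k ih =>
    rw [twist_pow_succ_apply, ih, hp,
      geom_sum_succ, pow_succ', ← pow_mul, mul_comm p]

end PolyG

/-! ### Vanishing over the finite field and W-polynomials -/

section Finite

variable {F : Type*} [Field F] [MulSemiringAction (Multiplicative ℕ) F] {p n : ℕ}

theorem act_polyG₀_one (hp : p.Prime) (hφ : ∀ a : F, φ a = a ^ p) (hF : ∀ a : F, a ^ p ^ n = a)
    {a : F} (ha : a ≠ 0) : act a (polyG₀ F p n) 1 = 0 := by
  -- With j = 0 and k = p - 1, the exponent reduces to (p-1)(1+p+...+p^(n-1)) = q - 1.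
  rw [polyG₀, act_sub, act_X_pow, twist_pow_one hφ, ← zero_add ((p - 1) * n),
    pow_geom_sum_add_mul hF, geom_sum_mul_pred hp n]
  have h1 : a ^ (p ^ n - 1) = 1 := by
    refine mul_right_cancel₀ ha ?_
    rw [pow_sub_one_mul (pow_pos hp.pos n).ne', hF, one_mul]
  simp [h1]

theorem act_polyG_one (hp : p.Prime) (hφ : ∀ a : F, φ a = a ^ p) (hF : ∀ a : F, a ^ p ^ n = a)
    (a : F) : act a (polyG F p n) 1 = 0 := by
  rw [polyG_eq_X_mul, act_mul, act_X]
  by_cases ha : a = 0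
  · rw [ha, zero_mul]
  · rw [act_polyG₀_one hp hφ hF ha, map_zero, mul_zero]

theorem eq_zero_of_forall_act_eq_zero (hp : p.Prime) (hφ : ∀ a : F, φ a = a ^ p)
    (hF : Nat.card F = p ^ n) {r : SkewPolynomial F}
    (hr : ∀ i, (p - 1) * n ≤ i → r.coeff i = 0) (h : ∀ a : F, a ≠ 0 → act a r 1 = 0) : r = 0 := by
  have : Finite F := Nat.finite_of_card_ne_zero (hF ▸ (pow_pos hp.pos n).ne')
  have := Fintype.ofFinite F
  have hcard : Fintype.card F = p ^ n := by rw [← Nat.card_eq_fintype_card, hF]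
  have hpow (a : F) : a ^ p ^ n = a := hcard ▸ FiniteField.pow_card a
  set S : ℕ → ℕ := fun j => ∑ i ∈ Finset.range j, p ^ i with hS
  -- The reduced exponent of t^i. As S(i % n) < S(n), division by S(n) recovers i / n and then i %
  -- n, so e is injective in the relevant range.
  set e : ℕ → ℕ := fun i => S (i % n) + i / n * S n with he
  have hSmono : StrictMono S := strictMono_nat_of_lt_succ fun k => by
    simp [hS, Finset.sum_range_succ, hp.pos]
  have hmod (i : ℕ) (hi : i < (p - 1) * n) : S (i % n) < S n :=
    hSmono (Nat.mod_lt _ (Nat.pos_of_mul_pos_left (Nat.zero_lt_of_lt hi)))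
  have he_lt (i : ℕ) (hi : i < (p - 1) * n) : e i < p ^ n - 1 := by
    have h1 : i / n + 1 ≤ p - 1 := Nat.div_lt_of_lt_mul (by rwa [mul_comm])
    calc e i < S n + i / n * S n := Nat.add_lt_add_right (hmod i hi) _
      _ = (i / n + 1) * S n := by ring
      _ ≤ (p - 1) * S n := Nat.mul_le_mul_right _ h1
      _ = _ := geom_sum_mul_pred hp n
  have he_inj (i j : ℕ) (hi : i < (p - 1) * n) (hj : j < (p - 1) * n) (hij : e i = e j) :
      i = j := by
    have hSn : 0 < S n := (Nat.zero_le _).trans_lt (hmod i hi)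
    have hd : i / n = j / n := by
      have := congrArg (· / S n) hij
      simpa [he, Nat.add_mul_div_right _ _ hSn, Nat.div_eq_of_lt (hmod i hi),
        Nat.div_eq_of_lt (hmod j hj)] using this
    have hm : i % n = j % n := hSmono.injective (by simpa [he, hd] using hij)
    rw [← Nat.div_add_mod i n, ← Nat.div_add_mod j n, hd, hm]
  let P : Polynomial F := ∑ i ∈ Finset.range ((p - 1) * n), Polynomial.monomial (e i) (r.coeff i)
  have hact (a : F) : act a r 1 = P.eval a := by
    have hsum : r = ∑ i ∈ Finset.range ((p - 1) * n), monomial i (r.coeff i) := by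
      conv_lhs => rw [← sum_monomial r]
      refine sum_eq_of_subset _ (fun i => map_zero _) fun i hi => ?_
      by_contra hi'
      exact mem_support_iff.1 hi (hr i (by simpa using hi'))
    have hev : act a r 1 = ∑ i ∈ Finset.range ((p - 1) * n), act a (monomial i (r.coeff i)) 1 := by
      conv_lhs => rw [hsum, map_sum]
      exact AddMonoidHom.finsetSum_apply _ _ _
    rw [hev, Polynomial.eval_finsetSum]
    refine Finset.sum_congr rfl fun i _ => ?_
    rw [act_monomial, Polynomial.eval_monomial, twist_pow_one hφ]
    congr 1
    rw [← pow_geom_sum_add_mul hpow, mul_comm, Nat.mod_add_div]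
  have hP : P = 0 := by
    classical
    refine Polynomial.eq_zero_of_natDegree_lt_card_of_eval_eq_zero' P (Finset.univ.erase 0)
      (fun a ha => ?_) ?_
    · rw [← hact]
      exact h a (Finset.ne_of_mem_erase ha)
    · rw [Finset.card_erase_of_mem (Finset.mem_univ _), Finset.card_univ, hcard]
      have hq : 0 < p ^ n - 1 := by
        have := Fintype.one_lt_card (α := F)
        omega
      refine (Polynomial.natDegree_sum_le_of_forall_le (n := p ^ n - 1 - 1) _ _
        fun i hi => (Polynomial.natDegree_monomial_le _).trans ?_).trans_lt (Nat.sub_one_lt_of_lt hq)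
      exact Nat.le_sub_one_of_lt (he_lt i (Finset.mem_range.1 hi))
  -- Injectivity of e means no two terms of P merge, so each coefficient of r is one of P.
  ext i
  by_cases hi : i < (p - 1) * n
  · have hc := congrArg (Polynomial.coeff · (e i)) hP
    simp only [P, Polynomial.finsetSum_coeff, Polynomial.coeff_monomial,
      Polynomial.coeff_zero] at hc
    rwa [Finset.sum_eq_single i, if_pos rfl] at hc
    · intro j hj hji
      rw [if_neg fun hij => hji (he_inj j i (Finset.mem_range.1 hj) hi hij)]
    · intro hi'
      exact absurd (Finset.mem_range.2 hi) hi'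
  · exact hr i (by omega)

theorem exists_eq_mul_polyG₀ (hp : p.Prime) (hφ : ∀ a : F, φ a = a ^ p)
    (hF : Nat.card F = p ^ n) (hd : 0 < (p - 1) * n) (hpow : ∀ a : F, a ^ p ^ n = a)
    {f : SkewPolynomial F} (h : ∀ a : F, a ≠ 0 → act a f 1 = 0) : ∃ u, f = u * polyG₀ F p n := by
  obtain ⟨u, r, rfl, hr⟩ := exists_eq_mul_add (isMonicOfDegree_polyG₀ (F := F) hd) f
  have hr0 : r = 0 := eq_zero_of_forall_act_eq_zero hp hφ hF hr fun a ha => by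
    have := h a ha
    rwa [act_add, act_mul, act_polyG₀_one hp hφ hpow ha, map_zero, zero_add] at this
  exact ⟨u, by rw [hr0, add_zero]⟩

theorem act_zero_polyG₀ (hd : 0 < (p - 1) * n) : act (0 : F) (polyG₀ F p n) 1 = -1 := by
  obtain ⟨k, hk⟩ : ∃ k, (p - 1) * n = k + 1 := ⟨_, (Nat.sub_add_cancel hd).symm⟩
  rw [polyG₀, hk, act_sub, pow_succ', act_mul, act_X, zero_mul, zero_sub,
    ← C_1, act_C, one_mul]

theorem exists_eq_mul_polyG (hp : p.Prime) (hφ : ∀ a : F, φ a = a ^ p)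
    (hF : Nat.card F = p ^ n) (hd : 0 < (p - 1) * n) (hpow : ∀ a : F, a ^ p ^ n = a)
    {f : SkewPolynomial F} (h : ∀ a : F, act a f 1 = 0) : ∃ u, f = u * polyG F p n := by
  obtain ⟨u, rfl⟩ := exists_eq_mul_polyG₀ hp hφ hF hd hpow fun a _ => h a
  have h0 := h 0
  -- G₀ takes the value -1 at 0, so the cofactor u itself vanishes at 0 and is a left multiple of t.
  rw [act_mul, act_zero_polyG₀ hd, map_neg, neg_eq_zero, act_one_eq_zero_iff, C_0, sub_zero] at h0
  obtain ⟨v, rfl⟩ := h0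
  exact ⟨v, by rw [polyG_eq_X_mul, mul_assoc]⟩

theorem isWPolynomial_iff (hp : p.Prime) (hφ : ∀ a : F, φ a = a ^ p)
    (hF : Nat.card F = p ^ n) (hd : 0 < (p - 1) * n) (hpow : ∀ a : F, a ^ p ^ n = a)
    (hn : ∀ a : F, φ^[n] a = a) (g : SkewPolynomial F) :
    IsWPolynomial g ↔ IsMonic g ∧ ∃ h, polyG F p n = h * g := by
  constructor
  · rintro ⟨r, hr, a, hspan⟩
    refine ⟨⟨r, hr⟩, ?_⟩
    rw [← mem_span_singleton_iff, hspan, Submodule.mem_iInf]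
    intro i
    rw [mem_span_singleton_iff, ← act_one_eq_zero_iff]
    exact act_polyG_one hp hφ hpow (a i)
  · rintro ⟨hg, hR⟩
    obtain ⟨w, hw⟩ := (exists_polyG_eq_mul_right_iff hn hd g).2 hR
    have hw0 : w ≠ 0 := by
      rintro rfl
      exact (isMonicOfDegree_polyG (F := F) hd).ne_zero (by rw [hw, mul_zero])
    refine isWPolynomial_of_forall_mem_iff hg
      -- The conjugates of a by the nonzero values w(a): there fw vanishes at a iff f vanishes at b.
      {b | ∃ a, act a w 1 ≠ 0 ∧ b = a * φ (act a w 1) * (act a w 1)⁻¹} fun f => ?_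
    have hfw : (∃ u, f = u * g) ↔ ∀ a, act a (f * w) 1 = 0 := by
      constructor
      · rintro ⟨u, rfl⟩ a
        rw [mul_assoc, ← hw, act_mul, act_polyG_one hp hφ hpow, map_zero]
      · intro h
        obtain ⟨u, hu⟩ := exists_eq_mul_polyG hp hφ hF hd hpow h
        exact ⟨u, mul_right_cancel₀ hw0 (by rw [hu, hw, mul_assoc])⟩
    rw [hfw]
    constructor
    · rintro h _ ⟨a, ha, rfl⟩
      rw [act_one_eq_zero_iff, ← act_eq_zero_iff a ha, ← act_mul]
      exact h a
    · intro h a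
      rw [act_mul]
      by_cases ha : act a w 1 = 0
      · rw [ha, map_zero]
      · rw [act_eq_zero_iff a ha, ← act_one_eq_zero_iff]
        exact h _ ⟨a, ha, rfl⟩

end Finite

end SkewPolynomial

theorem mainTheorem5 (p n : ℕ) [Fact p.Prime] (F : Type*) [Field F] [CharP F p]
    (hF : Nat.card F = p ^ n) :
    letI : MulSemiringAction (Multiplicative ℕ) F := endomorphismAction (frobenius F p)
    -- (a)
    (IsLeastLeftCommonMultiple {f | ∃ a : F, f = X - C a} (polyG F p n) ∧
      IsLeastLeftCommonMultiple {f | ∃ a : F, a ≠ 0 ∧ f = X - C a} (polyG₀ F p n)) ∧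
    -- (b)
    ((∀ h : SkewPolynomial F, polyG F p n * h = extendPhi h * polyG F p n) ∧
      polyG₀ F p n ∈ Subring.center (SkewPolynomial F)) ∧
    -- (c)
    (∀ g h : SkewPolynomial F, IsMonic g → IsMonic h →
      (h * g = polyG F p n → extendPhi g * h = polyG F p n) ∧
      (h * g = polyG₀ F p n → g * h = polyG₀ F p n)) ∧
    -- (d)
    (∀ g : SkewPolynomial F,
      (IsWPolynomial g ↔ IsMonic g ∧ ∃ h, polyG F p n = h * g) ∧
      (IsWPolynomial g ↔ IsMonic g ∧ ∃ h, polyG F p n = g * h)) := by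
  let _ : MulSemiringAction (Multiplicative ℕ) F := endomorphismAction (frobenius F p)
  have hp : p.Prime := Fact.out
  have hφ (a : F) : φ a = a ^ p := by
    rw [endomorphismAction_phi (frobenius F p), frobenius_def]
  have : Finite F := Nat.finite_of_card_ne_zero (hF ▸ (pow_pos hp.pos n).ne')
  have := Fintype.ofFinite F
  have hcard : Fintype.card F = p ^ n := by rw [← Nat.card_eq_fintype_card, hF]
  have hpow (a : F) : a ^ p ^ n = a := hcard ▸ FiniteField.pow_card a
  have hn (a : F) : φ^[n] a = a := by
    rw [endomorphismAction_phi (frobenius F p), iterate_frobenius, hpow]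
  -- n = 0 would give a field with one element.
  have hd : 0 < (p - 1) * n := by
    refine Nat.mul_pos (Nat.sub_pos_of_lt hp.one_lt) (Nat.pos_of_ne_zero ?_)
    rintro rfl
    exact (Fintype.one_lt_card (α := F)).ne' (by rw [hcard, pow_zero])
  refine ⟨⟨⟨⟨_, isMonicOfDegree_polyG hd⟩, ?_, ?_⟩, ⟨_, isMonicOfDegree_polyG₀ hd⟩, ?_, ?_⟩,
    ⟨polyG_mul hn, ?_⟩, fun g h _ _ => ⟨extendPhi_mul_of_mul_eq_polyG hn hd,
      mul_comm_of_mul_eq_polyG₀ hn hd⟩, fun g => ?_⟩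
  · rintro _ ⟨a, rfl⟩
    exact (act_one_eq_zero_iff a _).1 (act_polyG_one hp hφ hpow a)
  · intro f hf
    exact exists_eq_mul_polyG hp hφ hF hd hpow fun a => (act_one_eq_zero_iff a f).2 (hf _ ⟨a, rfl⟩)
  · rintro _ ⟨a, ha, rfl⟩
    exact (act_one_eq_zero_iff a _).1 (act_polyG₀_one hp hφ hpow ha)
  · intro f hf
    exact exists_eq_mul_polyG₀ hp hφ hF hd hpow fun a ha =>
      (act_one_eq_zero_iff a f).2 (hf _ ⟨a, ha, rfl⟩)
  · exact Subring.mem_center_iff.2 fun h => (polyG₀_mul_comm hn h).symm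
  · rw [exists_polyG_eq_mul_right_iff hn hd]
    exact ⟨isWPolynomial_iff hp hφ hF hd hpow hn g, isWPolynomial_iff hp hφ hF hd hpow hn g⟩
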